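/- Let $m,n\ge 0$ be integers. Put $X=\{x_1,\dots,x_m\}$, $Y=\{y_1,\dots,y_n\}$, $\widetilde X=X\uplus\{x_0\}$, $\widetilde Y=Y\uplus\{y_0\}$. Call the elements of $\mathcal L=X\uplus Y$ loops and the elements of $\widetilde{\mathcal E}=\bigl\{\{x_s,y_t\}: 0\le s\le m,\ 0\le t\le n,\ (s,t)\ne(0,0)\bigr\}$ edges. The noncrossing bipartite complex $\Delta(m,n)$ is the simplicial complex with vertex set $\mathcal L\uplus\widetilde{\mathcal E}$ whose faces are the subsets $\sigma$ (including $\varnothing$) such that 1. if an edge $\{x,y\}$ is in $\sigma$, then neither $x$ nor $y$ is a loop in $\sigma$; and 2. if the edges $\{x_{s_1},y_{t_1}\}$ and $\{x_{s_2},y_{t_2}\}$ are in $\sigma$ with $s_1<s_2$, then $t_1\le t_2$. The $F$-triangle of $\Delta(m,n)$ is the polynomial $$F_{m,n}(q,t)=\sum_{\sigma\in\Delta(m,n)} q^{|\sigma\cap\widetilde{\mathcal E}|}\,t^{|\sigma\cap\mathcal L|}\in\mathbb Z[q,t].$$ **Theorem.** For all $m,n\ge 0$, $$F_{m,n}(q,t)=\sum_{a=0}^{\min\{m,n\}}\binom{m}{a}\binom{n}{a}\,q^a(q+1)^a(q+t+1)^{m+n-2a},$$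 and moreover $$F_{m,n}(q,t)=(-1)^{m+n}F_{m,n}(-1-q,-1-t).$$ -/

import Mathlib

open MvPolynomial

namespace NoncrossingBipartite

/-- The loops `X ⊎ Y`: the element `Sum.inl i` is the letter `x_{i+1}` of `X = {x_1, …, x_m}`, and
`Sum.inr j` is the letter `y_{j+1}` of `Y = {y_1, …, y_n}`. -/
abbrev Loop (m n : ℕ) : Type := Fin m ⊕ Fin n

/-- The edges `{x_s, y_t}` with `0 ≤ s ≤ m` and `0 ≤ t ≤ n`, except for the edge `{x_0, y_0}`;
the edge `{x_s, y_t}` is represented by the pair `(s, t)`. -/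
abbrev Edge (m n : ℕ) : Type := {e : Fin (m + 1) × Fin (n + 1) // e ≠ (0, 0)}

/-- The vertices of the noncrossing bipartite complex: the disjoint union of loops and edges. -/
abbrev Vertex (m n : ℕ) : Type := Loop m n ⊕ Edge m n

/-- The set of all loops, as a set of vertices. -/
def loops (m n : ℕ) : Finset (Vertex m n) := Finset.univ.map Function.Embedding.inl

/-- The set of all edges, as a set of vertices. -/
def edges (m n : ℕ) : Finset (Vertex m n) := Finset.univ.map Function.Embedding.inr

/-- The conditions on the faces of the noncrossing bipartite complex. -/
structure IsFace {m n : ℕ} (σ : Finset (Vertex m n)) : Prop where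
  /-- If `{x, y} ∈ σ`, then the loop `x` is not in `σ` (where `x ∈ X`, that is, `x ≠ x_0`). -/
  left_notMem : ∀ e : Edge m n, Sum.inr e ∈ σ →
    ∀ i : Fin m, e.1.1 = i.succ → Sum.inl (Sum.inl i) ∉ σ
  /-- If `{x, y} ∈ σ`, then the loop `y` is not in `σ` (where `y ∈ Y`, that is, `y ≠ y_0`). -/
  right_notMem : ∀ e : Edge m n, Sum.inr e ∈ σ →
    ∀ j : Fin n, e.1.2 = j.succ → Sum.inl (Sum.inr j) ∉ σ
  /-- Edges in `σ` do not cross; they may have a common endpoint. -/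
  noncrossing : ∀ e f : Edge m n, Sum.inr e ∈ σ → Sum.inr f ∈ σ →
    e.1.1 < f.1.1 → e.1.2 ≤ f.1.2

/-- The noncrossing bipartite complex `Δ(m, n)`, as a family of sets of vertices that is closed
under taking subsets (the empty face included). -/
def complex (m n : ℕ) : LowerSet (Finset (Vertex m n)) where
  carrier := {σ | IsFace σ}
  lower' := fun _ _ h hσ =>
    ⟨fun e he i hi hl => hσ.left_notMem e (h he) i hi (h hl),
      fun e he j hj hl => hσ.right_notMem e (h he) j hj (h hl),
      fun e f he hf => hσ.noncrossing e f (h he) (h hf)⟩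

open Classical in
/-- The `F`-triangle of `Δ(m, n)`: a polynomial in `q = X 0`, which marks the edges of a face, and
`t = X 1`, which marks its loops. -/
noncomputable def fTriangle (m n : ℕ) : MvPolynomial (Fin 2) ℤ :=
  ∑ σ : Finset (Vertex m n) with σ ∈ complex m n,
    X 0 ^ (σ ∩ edges m n).card * X 1 ^ (σ ∩ loops m n).card

end NoncrossingBipartite

/-! The face conditions are pairwise, so faces are the cliques of a compatibility relation and F is
a clique polynomial, computed by deleting a vertex and adding its weight times the polynomial of its
link. In Δ(m+1, n+1) the loops x_{m+1} and y_{n+1} are removed this way. The corner edge {x_{m+1},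
y_{n+1}} is then compatible with every remaining vertex and contributes a factor 1 + q. Any other
edge at x_{m+1} crosses any other edge at y_{n+1}, so inclusion-exclusion applies to what is left.
This gives the recurrence `faceSum_box_succ_succ`; Pascal's rule gives the same one for the closed
form (`chooseSum_succ_succ`), and the boundary values agree. The symmetry is read off termwise: q ↦
-1-q, t ↦ -1-t fixes q(q+1) and negates q+t+1. -/

namespace NoncrossingBipartite

/-! ### Clique polynomials: deletion, union, transport. -/

section CliquePolynomial

variable {V R : Type*} [CommRing R]

open Classical in
/-- The generating polynomial, with vertex weights `w`, of the subsets of `U` whose elements are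
pairwise related by `r`. -/
noncomputable def cliquePoly (r : V → V → Prop) (w : V → R) (U : Finset V) : R :=
  ∑ σ ∈ U.powerset with ∀ u ∈ σ, ∀ v ∈ σ, r u v, ∏ v ∈ σ, w v

theorem cliquePoly_empty (r : V → V → Prop) (w : V → R) : cliquePoly r w ∅ = 1 := by
  simp [cliquePoly, Finset.filter_singleton]

open Classical in
/-- Deletion of a vertex: a clique of `insert a U` either avoids `a` or lies in the link of `a`. -/
theorem cliquePoly_insert [DecidableEq V] {r : V → V → Prop} (hrefl : ∀ v, r v v) (hsymm : ∀ u v, r u v → r v u)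
    (w : V → R) {a : V} {U L : Finset V} (ha : a ∉ U) (hL : ∀ v, v ∈ L ↔ v ∈ U ∧ r a v) :
    cliquePoly r w (insert a U) = cliquePoly r w U + w a * cliquePoly r w L := by
  unfold cliquePoly
  rw [Finset.sum_filter, Finset.sum_powerset_insert ha, Finset.mul_sum]
  congr 1
  · rw [Finset.sum_filter]
  trans ∑ σ ∈ U.powerset with ∀ u ∈ insert a σ, ∀ v ∈ insert a σ, r u v, ∏ v ∈ insert a σ, w v
  · rw [Finset.sum_filter]
    congr!
  have hsub : ∀ σ, (σ ⊆ U ∧ ∀ u ∈ insert a σ, ∀ v ∈ insert a σ, r u v) ↔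
      (σ ⊆ L ∧ ∀ u ∈ σ, ∀ v ∈ σ, r u v) := by
    intro σ
    simp only [Finset.subset_iff, hL, Finset.mem_insert]
    constructor
    · rintro ⟨h, h'⟩
      exact ⟨fun x hx => ⟨h hx, h' _ (Or.inl rfl) _ (Or.inr hx)⟩,
        fun u hu v hv => h' _ (Or.inr hu) _ (Or.inr hv)⟩
    · rintro ⟨h, h'⟩
      refine ⟨fun x hx => (h hx).1, ?_⟩
      rintro u (rfl | hu) v (rfl | hv)
      · exact hrefl _
      · exact (h hv).2
      · exact hsymm _ _ (h hu).2
      · exact h' _ hu _ hv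
  refine Finset.sum_congr ?_ ?_
  · ext σ
    simp only [Finset.mem_filter, Finset.mem_powerset, hsub]
  · intro σ hσ
    simp only [Finset.mem_filter, Finset.mem_powerset] at hσ
    exact Finset.prod_insert fun h => ha ((hL a).1 (hσ.1 h)).1

/-- If no element of `A \ B` is related to an element of `B \ A`, then every clique of `A ∪ B` lies
in `A` or in `B`. -/
theorem cliquePoly_union [DecidableEq V] {r : V → V → Prop} (w : V → R) {A B : Finset V}
    (h : ∀ a ∈ A, a ∉ B → ∀ b ∈ B, b ∉ A → ¬ r a b) :
    cliquePoly r w (A ∪ B) = cliquePoly r w A + cliquePoly r w B - cliquePoly r w (A ∩ B) := by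
  classical
  unfold cliquePoly
  rw [eq_sub_iff_add_eq]
  have hu : {σ ∈ (A ∪ B).powerset | ∀ u ∈ σ, ∀ v ∈ σ, r u v} =
      {σ ∈ A.powerset | ∀ u ∈ σ, ∀ v ∈ σ, r u v} ∪
        {σ ∈ B.powerset | ∀ u ∈ σ, ∀ v ∈ σ, r u v} := by
    ext σ
    simp only [Finset.mem_filter, Finset.mem_powerset, Finset.mem_union, ← or_and_right]
    refine and_congr_left fun hσ => ⟨fun hs => ?_, ?_⟩
    · by_contra! hcon
      obtain ⟨⟨x, hx, hxA⟩, y, hy, hyB⟩ := And.imp Finset.not_subset.1 Finset.not_subset.1 hcon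
      have hx' := (Finset.mem_union.1 (hs hx)).resolve_left hxA
      have hy' := (Finset.mem_union.1 (hs hy)).resolve_right hyB
      exact h y hy' hyB x hx' hxA (hσ y hy x hx)
    · rintro (hs | hs)
      · exact hs.trans Finset.subset_union_left
      · exact hs.trans Finset.subset_union_right
  have hi : {σ ∈ (A ∩ B).powerset | ∀ u ∈ σ, ∀ v ∈ σ, r u v} =
      {σ ∈ A.powerset | ∀ u ∈ σ, ∀ v ∈ σ, r u v} ∩
        {σ ∈ B.powerset | ∀ u ∈ σ, ∀ v ∈ σ, r u v} := by
    ext σ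
    simp only [Finset.mem_filter, Finset.mem_powerset, Finset.mem_inter, Finset.subset_inter_iff]
    tauto
  rw [hu, hi, Finset.sum_union_inter]
  congr!

/-- Cliques can be transported along an embedding. -/
theorem cliquePoly_map {V' : Type*} (φ : V' ↪ V) (r : V → V → Prop) (w : V → R)
    (U : Finset V') :
    cliquePoly r w (U.map φ) = cliquePoly (fun u v => r (φ u) (φ v)) (fun v => w (φ v)) U := by
  classical
  unfold cliquePoly
  symm
  refine Finset.sum_bij (fun σ _ => σ.map φ) ?_ ?_ ?_ ?_
  · intro σ hσ
    simpa using hσ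
  · intro σ _ τ _ h
    exact Finset.map_injective φ h
  · intro τ hτ
    simp only [Finset.mem_filter, Finset.mem_powerset] at hτ
    obtain ⟨σ, hσ, rfl⟩ := Finset.subset_map_iff.1 hτ.1
    exact ⟨σ, by simpa [hσ] using hτ.2, rfl⟩
  · intro σ _
    simp

end CliquePolynomial

/-! ### Recurrence for the face sums. -/

section Recurrence

/-- The vertices for unbounded `m` and `n`: loops `x_i`, loops `y_j`, and edges `{x_s, y_t}`. -/
abbrev NatVertex : Type := (ℕ ⊕ ℕ) ⊕ (ℕ × ℕ)

/-- Two vertices are compatible if they can lie in a common face. -/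
def Compat : NatVertex → NatVertex → Prop
  | .inl _, .inl _ => True
  | .inl (.inl i), .inr e => e.1 ≠ i
  | .inl (.inr j), .inr e => e.2 ≠ j
  | .inr e, .inl (.inl i) => e.1 ≠ i
  | .inr e, .inl (.inr j) => e.2 ≠ j
  | .inr e, .inr f => (e.1 < f.1 → e.2 ≤ f.2) ∧ (f.1 < e.1 → f.2 ≤ e.2)

theorem Compat.refl (v : NatVertex) : Compat v v := by
  rcases v with (i | j) | e <;> simp [Compat]

theorem Compat.symm (u v : NatVertex) (h : Compat u v) : Compat v u := by
  rcases u with (i | j) | e <;> rcases v with (i' | j') | e' <;> simp_all [Compat]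

/-- The vertices of `Δ(m, n)`. -/
def box (m n : ℕ) : Finset NatVertex :=
  ((Finset.Icc 1 m).disjSum (Finset.Icc 1 n)).disjSum
    ((Finset.range (m + 1) ×ˢ Finset.range (n + 1)).erase (0, 0))

@[simp] theorem left_mem_box {m n i : ℕ} : Sum.inl (Sum.inl i) ∈ box m n ↔ 1 ≤ i ∧ i ≤ m := by
  simp [box]

@[simp] theorem right_mem_box {m n j : ℕ} : Sum.inl (Sum.inr j) ∈ box m n ↔ 1 ≤ j ∧ j ≤ n := by
  simp [box]

@[simp] theorem edge_mem_box {m n s t : ℕ} :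
    Sum.inr (s, t) ∈ box m n ↔ ¬ (s = 0 ∧ t = 0) ∧ s ≤ m ∧ t ≤ n := by
  simp [box]

variable {R : Type*} [CommRing R] (q t : R)

/-- Loops have weight `t` and edges have weight `q`. -/
def weight : NatVertex → R := Sum.elim (fun _ => t) (fun _ => q)

/-- The sum of the weights of the faces that use only vertices in `U`. -/
noncomputable def faceSum (U : Finset NatVertex) : R := cliquePoly Compat (weight q t) U

theorem faceSum_insert {a : NatVertex} {S U L : Finset NatVertex} (hS : S = insert a U)
    (ha : a ∉ U) (hL : ∀ v, v ∈ L ↔ v ∈ U ∧ Compat a v) :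
    faceSum q t S = faceSum q t U + weight q t a * faceSum q t L :=
  hS ▸ cliquePoly_insert Compat.refl Compat.symm _ ha hL

theorem faceSum_box_zero_zero : faceSum q t (box 0 0) = 1 := by
  have : box 0 0 = ∅ := by decide
  rw [this]
  exact cliquePoly_empty _ _

/-- The faces of `Δ(m + 1, n)`, split according to the loop at `x_{m+1}`. -/
theorem faceSum_box_succ_left (m n : ℕ) :
    faceSum q t (box (m + 1) n) =
      faceSum q t ((box (m + 1) n).erase (.inl (.inl (m + 1)))) + t * faceSum q t (box m n) := by
  refine faceSum_insert q t (a := .inl (.inl (m + 1))) (Finset.insert_erase (by simp)).symm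
    (by simp) ?_
  rintro ((i | j) | ⟨a, b⟩) <;> simp [Compat] <;> omega

/-- The faces of `Δ(m, n + 1)`, split according to the loop at `y_{n+1}`. -/
theorem faceSum_box_succ_right (m n : ℕ) :
    faceSum q t (box m (n + 1)) =
      faceSum q t ((box m (n + 1)).erase (.inl (.inr (n + 1)))) + t * faceSum q t (box m n) := by
  refine faceSum_insert q t (a := .inl (.inr (n + 1))) (Finset.insert_erase (by simp)).symm
    (by simp) ?_
  rintro ((i | j) | ⟨a, b⟩) <;> simp [Compat] <;> omega

/-- With only y_0 on the other side no edges cross, so once the loop x_{m+1} is gone the edge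
{x_{m+1}, y_0} is a cone point over `box m 0`. -/
theorem faceSum_box_succ_zero (m : ℕ) :
    faceSum q t (box (m + 1) 0) = (q + t + 1) * faceSum q t (box m 0) := by
  have h : faceSum q t ((box (m + 1) 0).erase (.inl (.inl (m + 1)))) =
      faceSum q t (box m 0) + q * faceSum q t (box m 0) := by
    refine faceSum_insert q t (a := .inr (m + 1, 0)) ?_ (by simp) ?_
    · ext ((i | j) | ⟨a, b⟩) <;> simp <;> omega
    · rintro ((i | j) | ⟨a, b⟩) <;> simp [Compat] <;> omega
  rw [faceSum_box_succ_left, h]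
  ring

theorem faceSum_box_zero_succ (n : ℕ) :
    faceSum q t (box 0 (n + 1)) = (q + t + 1) * faceSum q t (box 0 n) := by
  have h : faceSum q t ((box 0 (n + 1)).erase (.inl (.inr (n + 1)))) =
      faceSum q t (box 0 n) + q * faceSum q t (box 0 n) := by
    refine faceSum_insert q t (a := .inr (0, n + 1)) ?_ (by simp) ?_
    · ext ((i | j) | ⟨a, b⟩) <;> simp <;> omega
    · rintro ((i | j) | ⟨a, b⟩) <;> simp [Compat] <;> omega
  rw [faceSum_box_succ_right, h]
  ring

theorem faceSum_box_succ_succ (m n : ℕ) :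
    faceSum q t (box (m + 1) (n + 1)) =
      (q + t + 1) * (faceSum q t (box m (n + 1)) + faceSum q t (box (m + 1) n)) -
        ((q + t + 1) ^ 2 - q * (q + 1)) * faceSum q t (box m n) := by
  -- `A` and `B` have the same loops as `box m n`. `A` adds the edges from x_{m+1} to y_0, …, y_n,
  -- and `B` those from y_{n+1} to x_0, …, x_m.
  let A := (box (m + 1) n).erase (.inl (.inl (m + 1)))
  let B := (box m (n + 1)).erase (.inl (.inr (n + 1)))
  have hx := faceSum_box_succ_left q t m (n + 1)
  have hA : faceSum q t (box (m + 1) n) = faceSum q t A + t * faceSum q t (box m n) :=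
    faceSum_box_succ_left q t m n
  have hB : faceSum q t (box m (n + 1)) = faceSum q t B + t * faceSum q t (box m n) :=
    faceSum_box_succ_right q t m n
  have hy : faceSum q t ((box (m + 1) (n + 1)).erase (.inl (.inl (m + 1)))) =
      faceSum q t (insert (.inr (m + 1, n + 1)) (A ∪ B)) + t * faceSum q t A := by
    refine faceSum_insert q t (a := .inl (.inr (n + 1))) ?_ (by simp [A, B]) ?_
    · ext ((i | j) | ⟨a, b⟩) <;> simp [A, B] <;> omega
    · rintro ((i | j) | ⟨a, b⟩) <;> simp [A, B, Compat] <;> omega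
  -- The corner edge is maximal in both coordinates and its two loops are gone, so its link is all
  -- of `A ∪ B`.
  have hc : faceSum q t (insert (.inr (m + 1, n + 1)) (A ∪ B)) =
      faceSum q t (A ∪ B) + q * faceSum q t (A ∪ B) := by
    refine faceSum_insert q t (a := .inr (m + 1, n + 1)) rfl (by simp [A, B]) ?_
    rintro ((i | j) | ⟨a, b⟩) <;> simp [A, B, Compat] <;> omega
  have hU : faceSum q t (A ∪ B) = faceSum q t A + faceSum q t B - faceSum q t (box m n) := by
    have hi : A ∩ B = box m n := by
      ext ((i | j) | ⟨a, b⟩) <;> simp [A, B] <;> omega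
    rw [← hi]
    refine cliquePoly_union _ ?_
    rintro ((i | j) | ⟨a, b⟩) h1 h2 ((i' | j') | ⟨a', b'⟩) h3 h4 <;>
      simp [A, B, Compat] at h1 h2 h3 h4 ⊢ <;> omega
  rw [hx, hy, hc, hU, hA]
  linear_combination (-(1 + q)) * hB

end Recurrence

/-! ### Recurrence for the closed form. -/

section ClosedForm

variable {R : Type*} [CommRing R] (A B : R)

/-- The sum `∑ a < K, C(m, a) C(n, a) A ^ a B ^ (m + n - 2 a)`. -/
def chooseSum (K m n : ℕ) : R :=
  ∑ a ∈ Finset.range K, A ^ a * (m.choose a * B ^ (m - a)) * (n.choose a * B ^ (n - a))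

/-- Pascal's rule, weighted by powers of B. If m < a + 1, the exponent m - (a + 1) truncates to 0,
harmlessly, since its binomial coefficient vanishes. -/
theorem choose_mul_pow_succ_succ (m a : ℕ) :
    (((m + 1).choose (a + 1) : ℕ) : R) * B ^ (m + 1 - (a + 1)) =
      B * (m.choose (a + 1) * B ^ (m - (a + 1))) + m.choose a * B ^ (m - a) := by
  rw [Nat.choose_succ_succ, Nat.add_sub_add_right]
  rcases le_or_gt (a + 1) m with h | h
  · obtain ⟨k, rfl⟩ := Nat.exists_eq_add_of_le h
    rw [show a + 1 + k - a = k + 1 by omega, show a + 1 + k - (a + 1) = k by omega]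
    push_cast
    ring
  · rw [Nat.choose_eq_zero_of_lt h]
    simp

/-- Pascal's rule applies to each binomial factor separately. The product u'v' of the lowered terms
carries one extra A, hence the bound K in the last sum. -/
theorem chooseSum_succ_succ (K m n : ℕ) :
    chooseSum A B (K + 1) (m + 1) (n + 1) =
      B * (chooseSum A B (K + 1) m (n + 1) + chooseSum A B (K + 1) (m + 1) n) -
        B ^ 2 * chooseSum A B (K + 1) m n + A * chooseSum A B K m n := by
  simp only [chooseSum, Finset.sum_range_succ' _ K, choose_mul_pow_succ_succ]
  -- Termwise, (Bu+u')(Bv+v') = Bu(Bv+v') + B(Bu+u')v - B²uv + u'v'.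
  have key : ∀ u u' v v' : ℕ → R,
      ∑ a ∈ Finset.range K, A ^ (a + 1) * (B * u a + u' a) * (B * v a + v' a) =
        B * ∑ a ∈ Finset.range K, A ^ (a + 1) * u a * (B * v a + v' a) +
          B * ∑ a ∈ Finset.range K, A ^ (a + 1) * (B * u a + u' a) * v a -
          B ^ 2 * ∑ a ∈ Finset.range K, A ^ (a + 1) * u a * v a +
          A * ∑ a ∈ Finset.range K, A ^ a * u' a * v' a := by
    intro u u' v v'
    simp only [Finset.mul_sum, ← Finset.sum_add_distrib, ← Finset.sum_sub_distrib]
    refine Finset.sum_congr rfl fun a _ => ?_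
    ring
  rw [key]
  simp only [Nat.choose_zero_right, Nat.sub_zero, pow_succ]
  ring

theorem chooseSum_eq_of_min_lt {K m n : ℕ} (h : min m n < K) :
    chooseSum A B K m n = ∑ a ∈ Finset.range (min m n + 1),
      ((m.choose a : R) * (n.choose a : R)) * A ^ a * B ^ (m + n - 2 * a) := by
  rw [chooseSum, ← Finset.sum_subset (Finset.range_subset_range.2 (Nat.succ_le_of_lt h))]
  · refine Finset.sum_congr rfl fun a ha => ?_
    have ha' := Finset.mem_range.1 ha
    rw [show m + n - 2 * a = (m - a) + (n - a) by omega, pow_add]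
    ring
  · intro a _ ha
    have : m < a ∨ n < a := by
      rw [Finset.mem_range] at ha
      omega
    rcases this with h | h <;> simp [Nat.choose_eq_zero_of_lt h]

theorem chooseSum_zero_right (K m : ℕ) : chooseSum A B (K + 1) m 0 = B ^ m := by
  simp [chooseSum, Finset.sum_range_succ']

theorem chooseSum_zero_left (K n : ℕ) : chooseSum A B (K + 1) 0 n = B ^ n := by
  simp [chooseSum, Finset.sum_range_succ']

theorem chooseSum_congr {K K' m n : ℕ} (h : min m n < K) (h' : min m n < K') :
    chooseSum A B K m n = chooseSum A B K' m n := by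
  rw [chooseSum_eq_of_min_lt A B h, chooseSum_eq_of_min_lt A B h']

end ClosedForm

/-! ### Identification with the F-triangle. -/

section FTriangle

theorem faceSum_box_eq {R : Type*} [CommRing R] (q t : R) (m n : ℕ) :
    faceSum q t (box m n) = chooseSum (q * (q + 1)) (q + t + 1) (m + n + 1) m n := by
  induction m generalizing n with
  | zero =>
    rw [chooseSum_zero_left]
    induction n with
    | zero => simp [faceSum_box_zero_zero]
    | succ n ih => rw [faceSum_box_zero_succ, ih, pow_succ']
  | succ m ihm =>
    induction n with
    | zero =>
      rw [chooseSum_zero_right, faceSum_box_succ_zero, ihm, chooseSum_zero_right, pow_succ']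
    | succ n ihn =>
      -- The truncation bounds differ, but all exceed the relevant minimum, so they can be made
      -- equal.
      rw [faceSum_box_succ_succ, chooseSum_succ_succ, ihm, ihn, ihm,
        chooseSum_congr _ _ (K := m + (n + 1) + 1) (K' := m + 1 + (n + 1) + 1) (by omega) (by omega),
        chooseSum_congr _ _ (K := m + 1 + n + 1) (K' := m + 1 + (n + 1) + 1) (by omega) (by omega),
        chooseSum_congr _ _ (m := m) (n := n) (K := m + n + 1) (K' := m + 1 + (n + 1) + 1)
          (by omega) (by omega),
        chooseSum_congr _ _ (m := m) (n := n) (K := m + 1 + (n + 1)) (K' := m + 1 + (n + 1) + 1)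
          (by omega) (by omega)]
      ring

/-- The vertices of `Δ(m, n)` as vertices with natural number indices. -/
def toNatVertex (m n : ℕ) : Vertex m n ↪ NatVertex where
  toFun := Sum.map (Sum.map (fun i => i.1 + 1) (fun j => j.1 + 1)) (fun e => (e.1.1.1, e.1.2.1))
  inj' := by
    refine Function.Injective.sumMap (Function.Injective.sumMap ?_ ?_) ?_
    · intro i j h
      exact Fin.ext (Nat.succ_injective h)
    · intro i j h
      exact Fin.ext (Nat.succ_injective h)
    · intro e f h
      exact Subtype.ext (Prod.ext (Fin.ext (Prod.ext_iff.1 h).1) (Fin.ext (Prod.ext_iff.1 h).2))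

theorem map_toNatVertex_univ (m n : ℕ) : Finset.univ.map (toNatVertex m n) = box m n := by
  ext ((i | j) | ⟨a, b⟩)
  · simp only [Finset.mem_map, Finset.mem_univ, true_and, left_mem_box]
    constructor
    · rintro ⟨((k | k) | e), hk⟩ <;> simp [toNatVertex] at hk
      omega
    · rintro ⟨h1, h2⟩
      exact ⟨.inl (.inl ⟨i - 1, by omega⟩), by simp [toNatVertex]; omega⟩
  · simp only [Finset.mem_map, Finset.mem_univ, true_and, right_mem_box]
    constructor
    · rintro ⟨((k | k) | e), hk⟩ <;> simp [toNatVertex] at hk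
      omega
    · rintro ⟨h1, h2⟩
      exact ⟨.inl (.inr ⟨j - 1, by omega⟩), by simp [toNatVertex]; omega⟩
  · simp only [Finset.mem_map, Finset.mem_univ, true_and, edge_mem_box]
    constructor
    · rintro ⟨((k | k) | ⟨⟨s, u⟩, he⟩), hk⟩ <;> simp [toNatVertex] at hk
      simp only [ne_eq, Prod.mk.injEq, Fin.ext_iff, Fin.val_zero] at he
      omega
    · rintro ⟨h1, h2, h3⟩
      refine ⟨.inr ⟨(⟨a, by omega⟩, ⟨b, by omega⟩), ?_⟩, rfl⟩
      simpa [Fin.ext_iff] using h1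

/-- Each face condition involves two vertices at a time. Loop indices are shifted by one, so index 0
of an edge never matches a loop. -/
theorem isFace_iff_compat {m n : ℕ} (σ : Finset (Vertex m n)) :
    IsFace σ ↔ ∀ u ∈ σ, ∀ v ∈ σ, Compat (toNatVertex m n u) (toNatVertex m n v) := by
  constructor
  · intro h
    have hl : ∀ e : Edge m n, Sum.inr e ∈ σ → ∀ i : Fin m, Sum.inl (Sum.inl i) ∈ σ →
        e.1.1.1 ≠ i.1 + 1 :=
      fun e he i hi hei => h.left_notMem e he i (Fin.ext hei) hi
    have hr : ∀ e : Edge m n, Sum.inr e ∈ σ → ∀ j : Fin n, Sum.inl (Sum.inr j) ∈ σ →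
        e.1.2.1 ≠ j.1 + 1 :=
      fun e he j hj hej => h.right_notMem e he j (Fin.ext hej) hj
    rintro ((i | j) | e) hu ((i' | j') | f) hv
    · trivial
    · trivial
    · exact hl f hv i hu
    · trivial
    · trivial
    · exact hr f hv j hu
    · exact hl e hu i' hv
    · exact hr e hu j' hv
    · exact ⟨h.noncrossing e f hu hv, h.noncrossing f e hv hu⟩
  · intro h
    exact ⟨fun e he i hi hl => h _ he _ hl (congrArg Fin.val hi),
      fun e he j hj hl => h _ he _ hl (congrArg Fin.val hj),
      fun e f he hf => (h _ he _ hf).1⟩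

theorem prod_weight {R : Type*} [CommRing R] (q t : R) {m n : ℕ} (σ : Finset (Vertex m n)) :
    ∏ v ∈ σ, weight q t (toNatVertex m n v) =
      q ^ (σ ∩ edges m n).card * t ^ (σ ∩ loops m n).card := by
  have mem_edges (e : Edge m n) : Sum.inr e ∈ edges m n :=
    Finset.mem_map_of_mem _ (Finset.mem_univ e)
  have hc : σ ∩ loops m n = {v ∈ σ | ¬ v ∈ edges m n} := by
    ext (l | e) <;> simp [mem_edges]
    · simp [loops, edges]
    · simp [loops]
  rw [← Finset.prod_filter_mul_prod_filter_not σ (· ∈ edges m n), hc,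
    ← Finset.filter_mem_eq_inter]
  congr 1 <;> apply Finset.prod_eq_pow_card <;> rintro (l | e) <;>
    simp [mem_edges, weight, toNatVertex]
  simp [edges]

theorem fTriangle_eq_faceSum (m n : ℕ) :
    fTriangle m n = faceSum (X 0 : MvPolynomial (Fin 2) ℤ) (X 1) (box m n) := by
  rw [← map_toNatVertex_univ, faceSum, cliquePoly_map, cliquePoly, fTriangle]
  refine Finset.sum_congr ?_ fun σ _ => (prod_weight _ _ σ).symm
  ext σ
  simp only [Finset.mem_filter, Finset.mem_univ, true_and, Finset.powerset_univ]
  exact isFace_iff_compat σ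

theorem fTriangle_eq_sum (m n : ℕ) :
    fTriangle m n =
      ∑ a ∈ Finset.range (min m n + 1),
        ((m.choose a : MvPolynomial (Fin 2) ℤ) * (n.choose a : MvPolynomial (Fin 2) ℤ)) *
          X 0 ^ a * (X 0 + 1) ^ a * (X 0 + X 1 + 1) ^ (m + n - 2 * a) := by
  rw [fTriangle_eq_faceSum, faceSum_box_eq, chooseSum_eq_of_min_lt _ _ (by omega)]
  simp only [mul_pow, mul_assoc]

end FTriangle

end NoncrossingBipartite

theorem mainTheorem4 (m n : ℕ) :
    NoncrossingBipartite.fTriangle m n =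
        ∑ a ∈ Finset.range (min m n + 1),
          ((m.choose a : MvPolynomial (Fin 2) ℤ) * (n.choose a : MvPolynomial (Fin 2) ℤ)) *
            X 0 ^ a * (X 0 + 1) ^ a * (X 0 + X 1 + 1) ^ (m + n - 2 * a) ∧
      NoncrossingBipartite.fTriangle m n =
        (-1) ^ (m + n) *
          bind₁ ![-1 - X 0, -1 - X 1] (NoncrossingBipartite.fTriangle m n) := by
  refine ⟨NoncrossingBipartite.fTriangle_eq_sum m n, ?_⟩
  rw [NoncrossingBipartite.fTriangle_eq_sum, map_sum, Finset.mul_sum]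
  refine Finset.sum_congr rfl fun a ha => ?_
  have ha' := Finset.mem_range.1 ha
  obtain ⟨k, hk⟩ := Nat.exists_eq_add_of_le (show 2 * a ≤ m + n by omega)
  simp only [map_mul, map_pow, map_add, map_one, map_natCast, bind₁_X_right, Matrix.cons_val_zero,
    Matrix.cons_val_one]
  rw [hk, Nat.add_sub_cancel_left,
    show (-1 - X 0 : MvPolynomial (Fin 2) ℤ) = -1 * (X 0 + 1) by ring,
    show (-1 * (X 0 + 1) + 1 : MvPolynomial (Fin 2) ℤ) = -1 * X 0 by ring,
    show (-1 * (X 0 + 1) + (-1 - X 1) + 1 : MvPolynomial (Fin 2) ℤ) = -1 * (X 0 + X 1 + 1) by ring,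
    mul_pow, mul_pow, mul_pow, pow_add, pow_mul]
  have h1 : ((-1 : MvPolynomial (Fin 2) ℤ) ^ a) * (-1) ^ a = 1 := by
    rw [← mul_pow]; simp
  have h2 : ((-1 : MvPolynomial (Fin 2) ℤ) ^ k) * (-1) ^ k = 1 := by
    rw [← mul_pow]; simp
  rw [neg_one_sq, one_pow, one_mul]
  -- The total sign is u²v²: u from each of the two a-th powers, v from the k-th power and v from
  -- the prefactor.
  generalize (-1 : MvPolynomial (Fin 2) ℤ) ^ a = u at *
  generalize (-1 : MvPolynomial (Fin 2) ℤ) ^ k = v at *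
  linear_combination (-((m.choose a : MvPolynomial (Fin 2) ℤ) * (n.choose a) * X 0 ^ a *
    (X 0 + 1) ^ a * (X 0 + X 1 + 1) ^ k)) * (u * u * h2 + h1)
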